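/- Let $V$ (variables) and $A$ (actions) be sets with $V$ infinite and $|A|\le|V|$, and let $\Sigma$ be a signature of function symbols with finite arities and $|\Sigma|\le|V|$. Let $P$ be a transition system specification (a collection of transition rules $\frac{H}{\alpha}$, with $H$ a possibly infinite set of literals $t\xrightarrow{a}t'$ or $t\not\xrightarrow{a}$ over $\Sigma$ and $V$) in tyft/tyxt format, that is: * all premises and conclusions of its rules are positive literals $t\xrightarrow{a}t'$; * in each rule the right-hand sides of the premises are variables that are all distinct and do not occur in the source (the left-hand side of the conclusion); * the source of each rule is either a variable, or a term $f(x_1,\dots,x_{ar(f)})$ with $f\in\Sigma$ and $x_1,\dots,x_{ar(f)}$ distinct variables. (No well-foundedness of the premises is assumed.) Let $P\vdash_{ws}\alpha$ denote that the closed literal $\alpha$ has a well-supported proof from $P$: a well-founded proof tree of closed literals in which each node $\beta$, with $K$ the set of labels of the nodes directly above it, is such that either $\frac{K}{\beta}$ is a closed substitution instance of a rule of $P$, or $\beta$ is negative and for every set $N$ of closed negative literals such that $\frac{N}{\gamma}$ is provable from $P$ for some closed literal $\gamma$ denying $\beta$, a literal in $K$ denies one in $N$. (The literals $t\xrightarrow{a}t'$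 and $t\not\xrightarrow{a}$ deny each other.) Then $P$ is complete: for every closed term $p$ and action $a$, either $P\vdash_{ws}p\xrightarrow{a}p'$ for some closed term $p'$, or $P\vdash_{ws}p\not\xrightarrow{a}$. Moreover, consider the labelled transition system whose processes are the closed terms over $\Sigma$ and whose transitions are those $p\xrightarrow{a}q$ with $P\vdash_{ws}p\xrightarrow{a}q$. A 1-nested simulation on it is a relation $R$ such that $p\mathrel{R}q$ and $p\xrightarrow{a}p'$ imply $q\xrightarrow{a}q'$ for some $q'$ with $p'\mathrel{R}q'$; for $n\ge2$, an $n$-nested simulation is a 1-nested simulation $R$ whose converse $R^{-1}$ is contained in an $(n-1)$-nested simulation. Write $p\sqsubseteq_{nS}q$ if $p\mathrel{R}q$ for some $n$-nested simulation $R$. Then for every $n\ge1$ the relation $\sqsubseteq_{nS}$ is a precongruence: it is a preorder on closed terms and, for all $f\in\Sigma$, if $p_i\sqsubseteq_{nS}q_i$ for $i=1,\dots,ar(f)$, then $f(p_1,\dots,p_{ar(f)})\sqsubseteq_{nS}f(q_1,\dots,q_{ar(f)})$. -/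

import Mathlib

/-- A labelled transition system with processes `Proc` and actions `A`; `Tr p a q` is `p -a-> q`. -/
structure LTS (Proc : Type*) (A : Type*) where
  Tr : Proc → A → Proc → Prop

namespace LTS

variable {Proc A : Type*}

/-- A (1-nested) simulation. -/
def IsSimulation (L : LTS Proc A) (R : Proc → Proc → Prop) : Prop :=
  ∀ p q, R p q → ∀ a p', L.Tr p a p' → ∃ q', L.Tr q a q' ∧ R p' q'

/-- `R` is an `n`-nested simulation, for `n ≥ 1`: a 1-nested simulation is a simulation, and
an `(n+1)`-nested simulation is a simulation whose converse is contained in an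
`n`-nested simulation. -/
inductive IsNestedSimulation (L : LTS Proc A) : ℕ → (Proc → Proc → Prop) → Prop
  | one {R : Proc → Proc → Prop} (hR : L.IsSimulation R) : IsNestedSimulation L 1 R
  | succ {n : ℕ} {R Q : Proc → Proc → Prop} (hn : 1 ≤ n) (hR : L.IsSimulation R)
      (hQ : IsNestedSimulation L n Q) (hRQ : ∀ p q, R q p → Q p q) :
      IsNestedSimulation L (n + 1) R

/-- The `n`-nested simulation preorder of an LTS. -/
def NestedSimPreorder (L : LTS Proc A) (n : ℕ) (p q : Proc) : Prop :=
  ∃ R : Proc → Proc → Prop, L.IsNestedSimulation n R ∧ R p q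

end LTS

/-- A signature: function symbols with finite arities. -/
structure Signature where
  Symb : Type*
  ar : Symb → ℕ

/-- Open terms over the signature `S` with variables from `V`. -/
inductive Term (S : Signature) (V : Type*) where
  | var (x : V) : Term S V
  | app (f : S.Symb) (ts : Fin (S.ar f) → Term S V) : Term S V

namespace Term

variable {S : Signature} {V : Type*}

/-- The variables occurring in a term. -/
def vars : Term S V → Set V
  | var x => {x}
  | app _ ts => ⋃ i, (ts i).vars

/-- A term is closed if no variable occurs in it. -/
def IsClosed (t : Term S V) : Prop := t.vars = ∅

/-- Application of a substitution. A partial substitution is represented by the total one that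
maps each variable outside its domain to itself. -/
def subst (σ : V → Term S V) : Term S V → Term S V
  | var x => σ x
  | app f ts => app f fun i => (ts i).subst σ

end Term

/-- The set `T(Σ)` of closed terms. -/
def ClosedTerm (S : Signature) (V : Type*) := {t : Term S V // t.IsClosed}

/-- Application of a function symbol to closed terms. -/
def ClosedTerm.app {S : Signature} {V : Type*} (f : S.Symb)
    (ps : Fin (S.ar f) → ClosedTerm S V) : ClosedTerm S V :=
  ⟨Term.app f fun i => (ps i).1, Set.iUnion_eq_empty.2 fun i => (ps i).2⟩

/-- A precongruence on closed terms: a preorder preserved by all function symbols. -/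
structure IsPrecongruence {S : Signature} {V : Type*}
    (r : ClosedTerm S V → ClosedTerm S V → Prop) : Prop where
  refl : ∀ p, r p p
  trans : ∀ p q s, r p q → r q s → r p s
  congr : ∀ (f : S.Symb) (ps qs : Fin (S.ar f) → ClosedTerm S V),
    (∀ i, r (ps i) (qs i)) → r (ClosedTerm.app f ps) (ClosedTerm.app f qs)

/-- Literals: `pos t a t'` is `t -a-> t'`, and `neg t a` is the negative literal (`t` has no `a`-transition). -/
inductive Literal (S : Signature) (V : Type*) (A : Type*) where
  | pos (t : Term S V) (a : A) (t' : Term S V) : Literal S V A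
  | neg (t : Term S V) (a : A) : Literal S V A

namespace Literal

variable {S : Signature} {V A : Type*}

/-- The left-hand side of a literal. -/
def lhs : Literal S V A → Term S V
  | pos t _ _ => t
  | neg t _ => t

def IsPos : Literal S V A → Prop
  | pos _ _ _ => True
  | neg _ _ => False

def IsNeg : Literal S V A → Prop
  | pos _ _ _ => False
  | neg _ _ => True

def IsClosed : Literal S V A → Prop
  | pos t _ t' => t.IsClosed ∧ t'.IsClosed
  | neg t _ => t.IsClosed

def subst (σ : V → Term S V) : Literal S V A → Literal S V A
  | pos t a t' => pos (t.subst σ) a (t'.subst σ)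
  | neg t a => neg (t.subst σ) a

/-- `pos t a u` and `neg t a` deny each other, for every term `u`. -/
inductive Denies : Literal S V A → Literal S V A → Prop
  | pos_neg (t : Term S V) (a : A) (t' : Term S V) : Denies (pos t a t') (neg t a)
  | neg_pos (t : Term S V) (a : A) (t' : Term S V) : Denies (neg t a) (pos t a t')

end Literal

/-- A transition rule: a (possibly infinite) set of premises and a conclusion. -/
structure TransitionRule (S : Signature) (V : Type*) (A : Type*) where
  premises : Set (Literal S V A)
  concl : Literal S V A

namespace TransitionRule

variable {S : Signature} {V A : Type*}

/-- The source of a rule: the left-hand side of its conclusion. -/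
def source (r : TransitionRule S V A) : Term S V := r.concl.lhs

/-- ntytt rules: the right-hand sides of the positive premises are variables that are all
distinct and that do not occur in the source. -/
structure IsNtytt (r : TransitionRule S V A) : Prop where
  rhs_var : ∀ t a u, Literal.pos t a u ∈ r.premises → ∃ y, u = Term.var y
  rhs_distinct : ∀ t a t' a' y, Literal.pos t a (Term.var y) ∈ r.premises →
    Literal.pos t' a' (Term.var y) ∈ r.premises → t = t' ∧ a = a'
  rhs_notMem : ∀ t a y, Literal.pos t a (Term.var y) ∈ r.premises → y ∉ r.source.vars

/-- ntyxt rules: ntytt rules whose source is a variable. -/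
def IsNtyxt (r : TransitionRule S V A) : Prop :=
  r.IsNtytt ∧ ∃ x, r.source = Term.var x

/-- ntyft rules: ntytt rules whose source contains exactly one function symbol and no multiple
occurrences of variables. -/
def IsNtyft (r : TransitionRule S V A) : Prop :=
  r.IsNtytt ∧ ∃ (f : S.Symb) (xs : Fin (S.ar f) → V), Function.Injective xs ∧
    r.source = Term.app f fun i => Term.var (xs i)

end TransitionRule

/-- A transition system specification over the signature `S`: a collection of rules. -/
structure TSS (S : Signature) (V : Type*) (A : Type*) where
  rules : Set (TransitionRule S V A)

namespace TSS

variable {S : Signature} {V A : Type*}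

/-- All conclusions are positive. -/
def IsStandard (P : TSS S V A) : Prop := ∀ r ∈ P.rules, r.concl.IsPos

/-- All conclusions and all premises are positive. -/
def IsPositive (P : TSS S V A) : Prop :=
  P.IsStandard ∧ ∀ r ∈ P.rules, ∀ h ∈ r.premises, h.IsPos

def IsNtyftNtyxt (P : TSS S V A) : Prop := ∀ r ∈ P.rules, r.IsNtyft ∨ r.IsNtyxt

/-- The tyft/tyxt format. -/
def IsTyftTyxt (P : TSS S V A) : Prop := P.IsPositive ∧ P.IsNtyftNtyxt

/-- `P.Provable K α`: the rule `K / α` is provable from `P`, i.e. there is a well-founded proof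
tree with root `α` whose hypotheses all lie in `K` and whose other nodes are inferred from the
nodes directly above them by substitution instances of rules of `P`. -/
inductive Provable (P : TSS S V A) (K : Set (Literal S V A)) : Literal S V A → Prop
  | hyp {α : Literal S V A} (h : α ∈ K) : Provable P K α
  | rule (r : TransitionRule S V A) (hr : r ∈ P.rules) (σ : V → Term S V)
      (h : ∀ β ∈ r.premises, Provable P K (β.subst σ)) : Provable P K (r.concl.subst σ)

/-- `P.WSProvable α`: the closed literal `α` has a well-supported proof from `P`. Step `rule` uses
closed substitution instances of rules; step `naf` (negation as failure) infers a closed negative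
literal `β` from a set `K` of literals such that for every set `N` of closed negative literals from
which some closed literal denying `β` is provable, a literal in `K` denies one in `N`. -/
inductive WSProvable (P : TSS S V A) : Literal S V A → Prop
  | rule (r : TransitionRule S V A) (hr : r ∈ P.rules) (σ : V → Term S V)
      (hσ : ∀ x, (σ x).IsClosed)
      (h : ∀ β ∈ r.premises, WSProvable P (β.subst σ)) : WSProvable P (r.concl.subst σ)
  | naf (β : Literal S V A) (hβ : β.IsNeg) (hc : β.IsClosed) (K : Set (Literal S V A))
      (hK : ∀ δ ∈ K, WSProvable P δ)
      (h : ∀ N : Set (Literal S V A), (∀ ν ∈ N, ν.IsNeg ∧ ν.IsClosed) →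
        ∀ γ : Literal S V A, γ.IsClosed → γ.Denies β → P.Provable N γ →
          ∃ δ ∈ K, ∃ ν ∈ N, δ.Denies ν) : WSProvable P β

/-- Completeness: every closed negative literal is either refuted or established by a
well-supported proof. -/
def IsComplete (P : TSS S V A) : Prop :=
  ∀ (p : ClosedTerm S V) (a : A),
    (∃ q : ClosedTerm S V, P.WSProvable (Literal.pos p.1 a q.1)) ∨
      P.WSProvable (Literal.neg p.1 a)

/-- The LTS associated to a (complete) TSS: the closed terms with the ws-provable transitions. -/
def lts (P : TSS S V A) : LTS (ClosedTerm S V) A where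
  Tr p a q := P.WSProvable (Literal.pos p.1 a q.1)

/-- The `n`-nested simulation preorder induced by a (complete) TSS. -/
def NestedSimPreorder (P : TSS S V A) (n : ℕ) : ClosedTerm S V → ClosedTerm S V → Prop :=
  P.lts.NestedSimPreorder n

end TSS

/-! ### Substitution and closed terms. -/

namespace Term

variable {S : Signature} {V W X : Type*}

/-! Completeness: rules have only positive premises, so negative hypotheses never help to derive a
transition. If `p` has no `a`-transition, negation as failure applies with no premises.

Precongruence: the context closure of a simulation `R` is again a simulation. A pair in it is a term
with markers for `R`-related pairs, read on the left and on the right. By induction on the proof of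
`p -a-> p'`, `WSProvable.exists_isLift` builds one function from markings of `p` to markings of `p'`
that yields transitions between the right readings. The premises of a rule may depend on each other
circularly, so the required marking of its variables solves a system of equations. Iteration from
the unmarked substitution only adds markers, and since terms are finite it stabilises at each
variable (`exists_marked_fixpoint`). Context closure commutes with converse, which carries the
result to all nesting depths. -/

/-- Simultaneous replacement of the variables of a term by terms over another set of variables. -/
def bind (ρ : V → Term S W) : Term S V → Term S W
  | var x => ρ x
  | app f ts => app f fun i => (ts i).bind ρ

theorem subst_eq_bind (σ : V → Term S V) (t : Term S V) : t.subst σ = t.bind σ := by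
  induction t with
  | var x => rfl
  | app f ts ih => simp only [subst, bind, ih]

theorem bind_bind (ρ : V → Term S W) (θ : W → Term S X) (t : Term S V) :
    (t.bind ρ).bind θ = t.bind fun x => (ρ x).bind θ := by
  induction t with
  | var x => rfl
  | app f ts ih => simp only [bind, ih]

theorem bind_var (t : Term S V) : t.bind var = t := by
  induction t with
  | var x => rfl
  | app f ts ih => simp only [bind, ih]

theorem bind_congr {ρ θ : V → Term S W} (t : Term S V) (h : ∀ x ∈ t.vars, ρ x = θ x) :
    t.bind ρ = t.bind θ := by
  induction t with
  | var x => exact h x rfl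
  | app f ts ih =>
    simp only [bind]
    congr 1
    funext i
    exact ih i fun x hx => h x (Set.mem_iUnion.2 ⟨i, hx⟩)

theorem subst_subst (σ τ : V → Term S V) (t : Term S V) :
    (t.subst σ).subst τ = t.subst fun x => (σ x).subst τ := by
  simp only [subst_eq_bind, bind_bind]

theorem IsClosed.subst_eq {t : Term S V} (ht : t.IsClosed) (σ : V → Term S V) :
    t.subst σ = t := by
  rw [subst_eq_bind]
  conv_rhs => rw [← bind_var t]
  refine bind_congr t fun x hx => ?_
  rw [IsClosed] at ht
  simp [ht] at hx

theorem isClosed_app {f : S.Symb} {ts : Fin (S.ar f) → Term S V} :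
    (app f ts).IsClosed ↔ ∀ i, (ts i).IsClosed := Set.iUnion_eq_empty

theorem isClosed_subst {σ : V → Term S V} (hσ : ∀ x, (σ x).IsClosed) (t : Term S V) :
    (t.subst σ).IsClosed := by
  induction t with
  | var x => exact hσ x
  | app f ts ih => exact isClosed_app.2 ih

end Term

namespace Literal

variable {S : Signature} {V A : Type*}

theorem subst_subst (σ τ : V → Term S V) (α : Literal S V A) :
    (α.subst σ).subst τ = α.subst fun x => (σ x).subst τ := by
  cases α <;> simp only [subst, Term.subst_subst]

theorem isPos_subst {σ : V → Term S V} {α : Literal S V A} : (α.subst σ).IsPos ↔ α.IsPos := by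
  cases α <;> rfl

end Literal

/-! ### Completeness of positive specifications. -/

namespace TSS

variable {S : Signature} {V A : Type*} {P : TSS S V A}

/-- All nodes below a positive root are positive, so no hypothesis from `N` occurs; `ρ` closes the
variables left open in the proof. -/
theorem Provable.wsProvable_subst (hP : P.IsPositive) {N : Set (Literal S V A)}
    (hN : ∀ ν ∈ N, ν.IsNeg) {ρ : V → Term S V} (hρ : ∀ x, (ρ x).IsClosed)
    {α : Literal S V A} (h : P.Provable N α) : α.IsPos → P.WSProvable (α.subst ρ) := by
  induction h with
  | @hyp α hα =>
    intro hpos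
    have := hN α hα
    cases α
    · exact this.elim
    · exact hpos.elim
  | rule r hr σ _ ih =>
    intro _
    rw [Literal.subst_subst]
    refine WSProvable.rule r hr _ (fun x => Term.isClosed_subst hρ _) fun β hβ => ?_
    rw [← Literal.subst_subst]
    exact ih β hβ (Literal.isPos_subst.2 (hP.2 r hr β hβ))

theorem IsPositive.isComplete (hP : P.IsPositive) : P.IsComplete := by
  intro p a
  by_cases hp : ∃ q : ClosedTerm S V, P.WSProvable (Literal.pos p.1 a q.1)
  · exact Or.inl hp
  refine Or.inr (WSProvable.naf _ trivial p.2 ∅ (by simp) fun N hN γ hγ hden hprov => ?_)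
  cases hden with
  | pos_neg _ _ t' =>
    refine (hp ⟨⟨t', hγ.2⟩, ?_⟩).elim
    have := hprov.wsProvable_subst hP (fun ν hν => (hN ν hν).1) (ρ := fun _ => p.1)
      (fun _ => p.2) trivial
    rwa [Literal.subst, p.2.subst_eq, hγ.2.subst_eq] at this

theorem WSProvable.isClosed {α : Literal S V A} (h : P.WSProvable α) : α.IsClosed := by
  cases h with
  | rule r _ σ hσ _ =>
    cases r.concl
    · exact ⟨Term.isClosed_subst hσ _, Term.isClosed_subst hσ _⟩
    · exact Term.isClosed_subst hσ _
  | naf _ _ hc => exact hc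

end TSS

/-! ### Nested simulations on an arbitrary transition system. -/

namespace LTS

variable {Proc A : Type*} {L : LTS Proc A}

theorem IsNestedSimulation.one_le {n : ℕ} {R : Proc → Proc → Prop}
    (h : L.IsNestedSimulation n R) : 1 ≤ n := by
  cases h <;> omega

theorem IsNestedSimulation.isSimulation {n : ℕ} {R : Proc → Proc → Prop}
    (h : L.IsNestedSimulation n R) : L.IsSimulation R := by
  cases h <;> assumption

theorem IsSimulation.nestedSimPreorder (n : ℕ) : L.IsSimulation (L.NestedSimPreorder n) := by
  rintro p q ⟨R, hR, hpq⟩ a p' hp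
  obtain ⟨q', hq, h⟩ := hR.isSimulation p q hpq a p' hp
  exact ⟨q', hq, R, hR, h⟩

/-- One relation witnesses all related pairs at once, so arguments of a function symbol related by
different simulations can be treated together. -/
theorem NestedSimPreorder.isNestedSimulation {n : ℕ} (hn : 1 ≤ n) :
    L.IsNestedSimulation n (L.NestedSimPreorder n) := by
  induction n, hn using Nat.le_induction with
  | base => exact .one (.nestedSimPreorder 1)
  | succ n hn ih =>
    refine .succ hn (.nestedSimPreorder _) ih ?_
    rintro p q ⟨R, hR, hqp⟩
    cases hR with
    | one => omega
    | succ _ _ hQ hRQ => exact ⟨_, hQ, hRQ p q hqp⟩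

theorem isNestedSimulation_eq {n : ℕ} (hn : 1 ≤ n) :
    L.IsNestedSimulation n (fun p q => p = q) := by
  have hsim : L.IsSimulation (fun p q => p = q) := by
    rintro p _ rfl a p' hp
    exact ⟨p', hp, rfl⟩
  induction n, hn using Nat.le_induction with
  | base => exact .one hsim
  | succ n hn ih => exact .succ hn hsim ih fun p q h => h.symm

theorem IsSimulation.comp {R Q : Proc → Proc → Prop} (hR : L.IsSimulation R)
    (hQ : L.IsSimulation Q) : L.IsSimulation (fun p s => ∃ q, R p q ∧ Q q s) := by
  rintro p s ⟨q, hpq, hqs⟩ a p' hp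
  obtain ⟨q', hq, h⟩ := hR p q hpq a p' hp
  obtain ⟨s', hs, h'⟩ := hQ q s hqs a q' hq
  exact ⟨s', hs, q', h, h'⟩

theorem IsNestedSimulation.comp {n : ℕ} {R Q : Proc → Proc → Prop}
    (hR : L.IsNestedSimulation n R) (hQ : L.IsNestedSimulation n Q) :
    L.IsNestedSimulation n (fun p s => ∃ q, R p q ∧ Q q s) := by
  induction n generalizing R Q with
  | zero => exact absurd hR.one_le (by omega)
  | succ n ih =>
    have hsim := hR.isSimulation.comp hQ.isSimulation
    cases hR with
    | one => exact .one hsim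
    | succ hn _ hR' hRR' =>
      cases hQ with
      | one => omega
      | succ _ _ hQ' hQQ' =>
        -- The converse of a composite composes the converses in the opposite order.
        refine .succ hn hsim (ih hQ' hR') ?_
        rintro p s ⟨q, h, h'⟩
        exact ⟨q, hQQ' _ _ h', hRR' _ _ h⟩

end LTS

/-! ### Marked terms and their order. -/

namespace Term

variable {S : Signature} {V X : Type*}

/-- Terms with variables from `V` in which certain subterms are replaced by markers from `X`. -/
abbrev Marked (S : Signature) (V X : Type*) := Term S (V ⊕ X)

/-- The marked term without markers given by a term. -/
def unmarked (X : Type*) (t : Term S V) : Marked S V X := t.bind fun x => var (Sum.inl x)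

/-- Replacement of all markers by the terms they stand for. -/
def eval (l : X → Term S V) (u : Marked S V X) : Term S V := u.bind (Sum.elim var l)

theorem eval_unmarked (l : X → Term S V) (t : Term S V) : (t.unmarked X).eval l = t := by
  rw [unmarked, eval, bind_bind]
  exact bind_var t

theorem eval_bind (l : X → Term S V) (τ : V → Marked S V X) (t : Term S V) :
    (t.bind τ).eval l = t.subst fun z => (τ z).eval l := by
  rw [eval, bind_bind, subst_eq_bind]
  rfl

theorem unmarked_subst (σ : V → Term S V) (t : Term S V) :
    (t.subst σ).unmarked X = t.bind fun z => (σ z).unmarked X := by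
  rw [subst_eq_bind, unmarked, bind_bind]
  rfl

theorem isClosed_eval {l m : X → Term S V} (hm : ∀ b, (m b).IsClosed) (u : Marked S V X)
    (hu : (u.eval l).IsClosed) : (u.eval m).IsClosed := by
  induction u with
  | var z =>
    cases z with
    | inl x => exact hu
    | inr b => exact hm b
  | app f us ih => exact isClosed_app.2 fun i => ih i (isClosed_app.1 hu i)

/-- `MarkLE l u v`: the marked term `v` is obtained from `u` by replacing unmarked subterms by
markers standing for them. -/
inductive MarkLE (l : X → Term S V) : Marked S V X → Marked S V X → Prop
  | mark (b : X) : MarkLE l ((l b).unmarked X) (var (Sum.inr b))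
  | var (z : V ⊕ X) : MarkLE l (var z) (var z)
  | app (f : S.Symb) (us vs : Fin (S.ar f) → Marked S V X) (h : ∀ i, MarkLE l (us i) (vs i)) :
      MarkLE l (app f us) (app f vs)

namespace MarkLE

variable {l : X → Term S V}

theorem refl (u : Marked S V X) : MarkLE l u u := by
  induction u with
  | var z => exact .var z
  | app f us ih => exact .app f us us ih

theorem unmarked_eval (u : Marked S V X) : MarkLE l ((u.eval l).unmarked X) u := by
  induction u with
  | var z =>
    cases z with
    | inl x => exact .var _
    | inr b => exact .mark b
  | app f us ih => exact .app f _ us ih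

theorem eval_eq {u v : Marked S V X} (h : MarkLE l u v) : u.eval l = v.eval l := by
  induction h with
  | mark b => exact eval_unmarked l (l b)
  | var z => rfl
  | app f us vs _ ih => exact congrArg (Term.app f) (funext ih)

theorem of_app {u v : Marked S V X} (h : MarkLE l u v) {f : S.Symb}
    {us vs : Fin (S.ar f) → Marked S V X} (hu : u = Term.app f us) (hv : v = Term.app f vs)
    (i : Fin (S.ar f)) : MarkLE l (us i) (vs i) := by
  cases h with
  | mark b => cases hv
  | var z => cases hv
  | app g us' vs' h =>
    cases hu
    cases hv
    exact h i

theorem bind {τ θ : V → Marked S V X} (h : ∀ z, MarkLE l (τ z) (θ z)) (t : Term S V) :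
    MarkLE l (t.bind τ) (t.bind θ) := by
  induction t with
  | var z => exact h z
  | app f ts ih => exact .app f _ _ ih

/-- The number of nodes of a marked term other than markers. -/
def size : Marked S V X → ℕ
  | Term.var (Sum.inl _) => 1
  | Term.var (Sum.inr _) => 0
  | Term.app _ us => 1 + ∑ i, size (us i)

theorem size_unmarked_pos (t : Term S V) : 0 < size (t.unmarked X) := by
  cases t with
  | var x => exact Nat.one_pos
  | app f ts => exact Nat.add_pos_left Nat.one_pos _

theorem size_le {u v : Marked S V X} (h : MarkLE l u v) : size v ≤ size u := by
  induction h with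
  | mark b => exact Nat.zero_le _
  | var z => exact le_rfl
  | app f us vs _ ih => exact Nat.add_le_add_left (Finset.sum_le_sum fun i _ => ih i) 1

/-- Each new marker replaces a subterm of positive size, so a strict step lowers `size`; hence
ascending chains stabilise. -/
theorem eq_of_size_eq {u v : Marked S V X} (h : MarkLE l u v) (hs : size v = size u) :
    u = v := by
  induction h with
  | mark b => exact absurd hs (size_unmarked_pos (l b)).ne
  | var z => rfl
  | app f us vs hle ih =>
    have hsum : ∑ i, size (vs i) = ∑ i, size (us i) := Nat.add_left_cancel hs
    rw [Finset.sum_eq_sum_iff_of_le fun i _ => (hle i).size_le] at hsum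
    exact congrArg (Term.app f) (funext fun i => ih i (hsum i (Finset.mem_univ i)))

theorem eventually_const {s : ℕ → Marked S V X} (h : ∀ n, MarkLE l (s n) (s (n + 1))) :
    ∃ u, ∀ᶠ n in Filter.atTop, s n = u := by
  have hanti : Antitone fun n => size (s n) := antitone_nat_of_succ_le fun n => (h n).size_le
  obtain ⟨N, hN⟩ := WellFoundedLT.antitone_chain_condition hanti
  refine ⟨s N, Filter.eventually_atTop.2 ⟨N, fun n hn => ?_⟩⟩
  induction n, hn using Nat.le_induction with
  | base => rfl
  | succ n hn ih =>
    rw [← ih]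
    exact ((h n).eq_of_size_eq ((hN _ (hn.trans n.le_succ)).symm.trans (hN n hn))).symm

end MarkLE

/-- `IsLift l p p' F`: the function `F` maps markings of `p` to markings of `p'`, monotonically,
and such that the unmarked `p` is sent to the unmarked `p'`. -/
structure IsLift (l : X → Term S V) (p p' : Term S V) (F : Marked S V X → Marked S V X) :
    Prop where
  eval : ∀ u, u.eval l = p → (F u).eval l = p'
  mono : ∀ u v, u.eval l = p → MarkLE l u v → MarkLE l (F u) (F v)
  unmarked : F (p.unmarked X) = p'.unmarked X

/-! ### Solving circular systems of equations between markings. -/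

section Fixpoint

variable {l : X → Term S V} {σ : V → Term S V}
  {D : V → Option (Term S V × (Marked S V X → Marked S V X))} {β γ : V → Marked S V X}

/-- Iterates, starting with the unmarked substitution `σ`, of the system of equations
`z = F (t.bind -)` where `D z = (t, F)`, and `z = β z` where `D z` is undefined. -/
def markIter (σ : V → Term S V) (D : V → Option (Term S V × (Marked S V X → Marked S V X)))
    (β : V → Marked S V X) : ℕ → V → Marked S V X
  | 0, z => (σ z).unmarked X
  | n + 1, z => (D z).elim (β z) fun d => d.2 (d.1.bind (markIter σ D β n))

theorem eval_markIter (hD : ∀ z, ∀ d ∈ D z, IsLift l (d.1.subst σ) (σ z) d.2)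
    (hβ : ∀ z, (β z).eval l = σ z) (n : ℕ) (z : V) : (markIter σ D β n z).eval l = σ z := by
  induction n generalizing z with
  | zero => exact eval_unmarked l (σ z)
  | succ n ih =>
    rw [markIter]
    cases h : D z with
    | none => exact hβ z
    | some d =>
      refine (hD z d h).eval _ ?_
      simp only [eval_bind, ih]

theorem markIter_mono (hD : ∀ z, ∀ d ∈ D z, IsLift l (d.1.subst σ) (σ z) d.2)
    (hβ : ∀ z, (β z).eval l = σ z) (hβγ : ∀ z, MarkLE l (β z) (γ z)) (n : ℕ) (z : V) :
    MarkLE l (markIter σ D β n z) (markIter σ D γ n z) := by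
  induction n generalizing z with
  | zero => exact .refl _
  | succ n ih =>
    simp only [markIter]
    cases h : D z with
    | none => exact hβγ z
    | some d =>
      refine (hD z d h).mono _ _ ?_ (.bind ih _)
      simp only [eval_bind, eval_markIter hD hβ]

/-- The iteration starts at the least marking of `σ`, and lifts are monotone. -/
theorem markIter_le_succ (hD : ∀ z, ∀ d ∈ D z, IsLift l (d.1.subst σ) (σ z) d.2)
    (hβ : ∀ z, (β z).eval l = σ z) (n : ℕ) (z : V) :
    MarkLE l (markIter σ D β n z) (markIter σ D β (n + 1) z) := by
  induction n generalizing z with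
  | zero =>
    have := MarkLE.unmarked_eval (l := l) (markIter σ D β 1 z)
    rwa [eval_markIter hD hβ] at this
  | succ n ih =>
    rw [markIter, markIter]
    cases h : D z with
    | none => exact .refl _
    | some d =>
      refine (hD z d h).mono _ _ ?_ (.bind ih _)
      simp only [eval_bind, eval_markIter hD hβ]

theorem markIter_unmarked (hD : ∀ z, ∀ d ∈ D z, IsLift l (d.1.subst σ) (σ z) d.2) (n : ℕ)
    (z : V) : markIter σ D (fun z => (σ z).unmarked X) n z = (σ z).unmarked X := by
  induction n generalizing z with
  | zero => rfl
  | succ n ih =>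
    rw [markIter]
    cases h : D z with
    | none => rfl
    | some d =>
      have := (hD z d h).unmarked
      rw [unmarked_subst] at this
      rw [Option.elim, bind_congr d.1 fun x _ => ih x]
      exact this

/-- Stabilisation is only pointwise in the variable, but finite arities leave finitely many stages
to wait for. -/
theorem eventually_bind_eq {s : ℕ → V → Marked S V X} {τ : V → Marked S V X}
    (h : ∀ z, ∀ᶠ n in Filter.atTop, s n z = τ z) (t : Term S V) :
    ∀ᶠ n in Filter.atTop, t.bind (s n) = t.bind τ := by
  induction t with
  | var z => exact h z
  | app f ts ih =>
    filter_upwards [Filter.eventually_all.2 ih] with n hn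
    exact congrArg (app f) (funext hn)

/-- A system of equations given by lifts has a solution that is monotone in its parameters. -/
theorem exists_marked_fixpoint (hD : ∀ z, ∀ d ∈ D z, IsLift l (d.1.subst σ) (σ z) d.2) :
    ∃ τ : (V → Marked S V X) → V → Marked S V X,
      (∀ β, (∀ z, (β z).eval l = σ z) → ∀ z, (τ β z).eval l = σ z ∧
        (D z = none → τ β z = β z) ∧ ∀ d ∈ D z, τ β z = d.2 (d.1.bind (τ β))) ∧
      (∀ β γ, (∀ z, (β z).eval l = σ z) → (∀ z, MarkLE l (β z) (γ z)) →
        ∀ z, MarkLE l (τ β z) (τ γ z)) ∧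
      ∀ z, τ (fun z => (σ z).unmarked X) z = (σ z).unmarked X := by
  have hex : ∀ (β : V → Marked S V X) (z : V), ∃ u, (∀ z, (β z).eval l = σ z) →
      ∀ᶠ n in Filter.atTop, markIter σ D β n z = u := by
    intro β z
    by_cases hβ : ∀ z, (β z).eval l = σ z
    · obtain ⟨u, hu⟩ := MarkLE.eventually_const fun n => markIter_le_succ hD hβ n z
      exact ⟨u, fun _ => hu⟩
    · exact ⟨β z, fun h => (hβ h).elim⟩
  choose τ hτ using hex
  refine ⟨τ, fun β hβ z => ⟨?_, fun h => ?_, fun d hd => ?_⟩, fun β γ hβ hβγ z => ?_, fun z => ?_⟩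
  · obtain ⟨n, hn⟩ := (hτ β z hβ).exists
    rw [← hn, eval_markIter hD hβ]
  · obtain ⟨n, hn⟩ := ((Filter.tendsto_add_atTop_nat 1).eventually (hτ β z hβ)).exists
    rw [← hn, markIter, h]
    rfl
  -- A stage `n` where `d.1` already has its limit value and stage `n + 1` is the limit at `z`.
  · obtain ⟨n, hn, hn'⟩ := (((Filter.tendsto_add_atTop_nat 1).eventually (hτ β z hβ)).and
      (eventually_bind_eq (fun z => hτ β z hβ) d.1)).exists
    rw [← hn, markIter, Option.mem_def.1 hd, ← hn']
    rfl
  · have hγ : ∀ z, (γ z).eval l = σ z := fun z => (hβγ z).eval_eq.symm.trans (hβ z)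
    obtain ⟨n, hn, hn'⟩ := ((hτ β z hβ).and (hτ γ z hγ)).exists
    rw [← hn, ← hn']
    exact markIter_mono hD hβ hβγ n z
  · obtain ⟨n, hn⟩ := (hτ _ z fun z => eval_unmarked l (σ z)).exists
    rw [← hn, markIter_unmarked hD]

end Fixpoint

/-! ### Matching the source of a rule against a marked term. -/

/-- A marked term that is a single marker. -/
def IsMark : Marked S V X → Prop
  | var (Sum.inr _) => True
  | _ => False

/-- `IsMatch l s σ M`: for every marking `u` of `s.subst σ` that is not a marker, `M u` is a marking
of the substitution `σ` that turns `s` into `u`; it depends monotonically on `u`. -/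
structure IsMatch (l : X → Term S V) (s : Term S V) (σ : V → Term S V)
    (M : Marked S V X → V → Marked S V X) : Prop where
  bind : ∀ u, u.eval l = s.subst σ → ¬ u.IsMark → s.bind (M u) = u
  eval : ∀ u, u.eval l = s.subst σ → ¬ u.IsMark → ∀ z, (M u z).eval l = σ z
  mono : ∀ u v, u.eval l = s.subst σ → ¬ u.IsMark → ¬ v.IsMark → MarkLE l u v →
    ∀ z, MarkLE l (M u z) (M v z)
  unmarked : M ((s.subst σ).unmarked X) = fun z => (σ z).unmarked X

theorem not_isMark_unmarked (t : Term S V) : ¬ (t.unmarked X).IsMark := by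
  cases t <;> exact id

theorem exists_isMatch_var (l : X → Term S V) (x : V) (σ : V → Term S V) :
    ∃ M, IsMatch l (var x) σ M := by
  classical
  refine ⟨fun u z => if z = x then u else (σ z).unmarked X, ?_, ?_, ?_, ?_⟩
  · intro u _ _
    exact if_pos rfl
  · intro u hu _ z
    split_ifs with h
    · rw [h]
      exact hu
    · exact eval_unmarked l _
  · intro u v _ _ _ huv z
    split_ifs
    · exact huv
    · exact .refl _
  · funext z
    split_ifs with h
    · rw [h]
      rfl
    · rfl

/-- The `k`-th argument of a term. -/
def arg (k : ℕ) : Term S V → Term S V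
  | var x => var x
  | app f ts => if h : k < S.ar f then ts ⟨k, h⟩ else app f ts

theorem arg_app (f : S.Symb) (ts : Fin (S.ar f) → Term S V) (i : Fin (S.ar f)) :
    (app f ts).arg i = ts i := dif_pos i.2

theorem exists_isMatch_app (l : X → Term S V) (f : S.Symb) (xs : Fin (S.ar f) → V)
    (hxs : Function.Injective xs) (σ : V → Term S V) :
    ∃ M, IsMatch l (app f fun i => var (xs i)) σ M := by
  classical
  have key : ∀ u : Marked S V X, u.eval l = (app f fun i => var (xs i)).subst σ → ¬ u.IsMark →
      ∃ us, u = app f us ∧ ∀ i, (us i).eval l = σ (xs i) := by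
    intro u hu hm
    cases u with
    | var z =>
      cases z with
      | inl x => cases hu
      | inr b => exact (hm trivial).elim
    | app g us =>
      simp only [eval, Term.bind, subst, app.injEq] at hu
      obtain ⟨rfl, h⟩ := hu
      exact ⟨us, rfl, fun i => congrFun (eq_of_heq h) i⟩
  -- `M` must be total, whatever the head symbol of `u`; hence the numeric index in `arg`.
  let M : Marked S V X → V → Marked S V X := fun u z =>
    if h : ∃ i, xs i = z then u.arg (h.choose : ℕ) else (σ z).unmarked X
  have hM : ∀ us i, M (app f us) (xs i) = us i := by
    intro us i
    have h : ∃ j, xs j = xs i := ⟨i, rfl⟩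
    simp only [M, dif_pos h, hxs h.choose_spec, arg_app]
  have hM' : ∀ u z, (¬ ∃ i, xs i = z) → M u z = (σ z).unmarked X := fun u z h => dif_neg h
  refine ⟨M, ?_, ?_, ?_, ?_⟩
  · intro u hu hm
    obtain ⟨us, rfl, -⟩ := key u hu hm
    exact congrArg (app f) (funext fun i => hM us i)
  · intro u hu hm z
    obtain ⟨us, rfl, hus⟩ := key u hu hm
    by_cases h : ∃ i, xs i = z
    · obtain ⟨i, rfl⟩ := h
      rw [hM, hus]
    · rw [hM' _ _ h, eval_unmarked]
  · intro u v hu hm hm' huv z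
    obtain ⟨us, rfl, -⟩ := key u hu hm
    obtain ⟨vs, rfl, -⟩ := key v (huv.eval_eq ▸ hu) hm'
    by_cases h : ∃ i, xs i = z
    · obtain ⟨i, rfl⟩ := h
      rw [hM, hM]
      exact huv.of_app rfl rfl i
    · rw [hM' _ _ h, hM' _ _ h]
      exact .refl _
  · funext z
    by_cases h : ∃ i, xs i = z
    · obtain ⟨i, rfl⟩ := h
      exact hM _ i
    · exact hM' _ _ h

end Term

/-! ### Context closure and the precongruence property. -/

namespace TSS

open Term

variable {S : Signature} {V A : Type*} {P : TSS S V A}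

/-- Markers for the closure of a relation under contexts: pairs of related closed terms. -/
abbrev Pairs (R : ClosedTerm S V → ClosedTerm S V → Prop) :=
  {b : ClosedTerm S V × ClosedTerm S V // R b.1 b.2}

/-- The closed term on the left of a pair. -/
def Pairs.left {R : ClosedTerm S V → ClosedTerm S V → Prop} (b : Pairs R) : Term S V := b.1.1.1

/-- The closed term on the right of a pair. -/
def Pairs.right {R : ClosedTerm S V → ClosedTerm S V → Prop} (b : Pairs R) : Term S V := b.1.2.1

/-- The closure of a relation on closed terms under contexts. -/
def contextClosure (R : ClosedTerm S V → ClosedTerm S V → Prop) (p q : ClosedTerm S V) : Prop :=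
  ∃ u : Marked S V (Pairs R), u.eval Pairs.left = p.1 ∧ u.eval Pairs.right = q.1

/-- A single `F` must serve all markings `u`: the markings of the premises' left-hand sides are
known only once the equations between the lifts of the premises are solved. -/
theorem WSProvable.exists_isLift (hP : P.IsTyftTyxt)
    {R : ClosedTerm S V → ClosedTerm S V → Prop} (hR : P.lts.IsSimulation R)
    {α : Literal S V A} (hα : P.WSProvable α) :
    ∀ p a p', α = Literal.pos p a p' →
      ∃ F : Marked S V (Pairs R) → Marked S V (Pairs R), IsLift Pairs.left p p' F ∧
        ∀ u, u.eval Pairs.left = p →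
          P.WSProvable (Literal.pos (u.eval Pairs.right) a ((F u).eval Pairs.right)) := by
  induction hα with
  | naf β hβ =>
    rintro p a p' rfl
    exact hβ.elim
  | rule r hr σ hσ hprem ih =>
    intro p a p' hconcl
    have hpp' : P.WSProvable (Literal.pos p a p') := hconcl ▸ WSProvable.rule r hr σ hσ hprem
    obtain ⟨s, t, hst, rfl, rfl⟩ : ∃ s t, r.concl = Literal.pos s a t ∧
        s.subst σ = p ∧ t.subst σ = p' := by
      cases hc : r.concl with
      | pos s b t =>
        rw [hc, Literal.subst, Literal.pos.injEq] at hconcl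
        obtain ⟨h1, rfl, h2⟩ := hconcl
        exact ⟨s, t, rfl, h1, h2⟩
      | neg s b =>
        rw [hc, Literal.subst] at hconcl
        cases hconcl
    have hsrc : r.source = s := by rw [TransitionRule.source, hst]; rfl
    have hform := hP.2 r hr
    have hnt : r.IsNtytt := hform.elim And.left And.left
    obtain ⟨M, hM⟩ : ∃ M, IsMatch (Pairs.left (R := R)) s σ M := by
      rcases hform with ⟨-, f, xs, hxs, h⟩ | ⟨-, x, h⟩
      · rw [← hsrc, h]
        exact exists_isMatch_app _ f xs hxs σ
      · rw [← hsrc, h]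
        exact exists_isMatch_var _ x σ
    -- the system of equations given by the premises
    have hD : ∀ z, ∃ o : Option (Term S V × (Marked S V (Pairs R) → Marked S V (Pairs R))),
        (∀ d ∈ o, IsLift Pairs.left (d.1.subst σ) (σ z) d.2) ∧
        (o = none ∨ ∃ t a, Literal.pos t a (var z) ∈ r.premises) ∧
        ∀ t a, Literal.pos t a (var z) ∈ r.premises → ∃ d ∈ o, d.1 = t ∧
          ∀ u, u.eval Pairs.left = t.subst σ →
            P.WSProvable (Literal.pos (u.eval Pairs.right) a ((d.2 u).eval Pairs.right)) := by
      intro z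
      by_cases hz : ∃ t a, Literal.pos t a (var z) ∈ r.premises
      · obtain ⟨t, b, htb⟩ := hz
        obtain ⟨F, hF, hF'⟩ := ih _ htb _ _ _ rfl
        refine ⟨some (t, F), ?_, Or.inr ⟨t, b, htb⟩, fun t' b' h' => ?_⟩
        · rintro d ⟨⟩
          exact hF
        · obtain ⟨rfl, rfl⟩ := hnt.rhs_distinct _ _ _ _ _ htb h'
          exact ⟨_, rfl, rfl, hF'⟩
      · exact ⟨none, by simp, Or.inl rfl, fun t b h => (hz ⟨t, b, h⟩).elim⟩
    choose D hDlift hDnone hDprem using hD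
    obtain ⟨τ, hτ, hτmono, hτun⟩ := exists_marked_fixpoint hDlift
    -- Source variables are not targets of premises, so they carry no equation and keep the marking
    -- given by `M u`.
    have hsource : ∀ u, u.eval Pairs.left = s.subst σ → ¬ u.IsMark → s.bind (τ (M u)) = u := by
      intro u hu hm
      conv_rhs => rw [← hM.bind u hu hm]
      refine bind_congr s fun x hx => ?_
      refine (hτ (M u) (hM.eval u hu hm) x).2.1 ((hDnone x).resolve_right ?_)
      rintro ⟨t', b, h⟩
      exact hnt.rhs_notMem t' b x h (hsrc ▸ hx)
    -- If the whole source is one marker, no rule is applied: `R` itself simulates the step.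
    have hmark : ∀ b : Pairs R, ∃ c : Pairs R, b.left = s.subst σ → c.left = t.subst σ ∧
        P.WSProvable (Literal.pos b.right a c.right) := by
      intro b
      by_cases hb : b.left = s.subst σ
      · obtain ⟨q', hq, hR'⟩ := hR _ _ b.2 a ⟨t.subst σ, hpp'.isClosed.2⟩
          (by change P.WSProvable (Literal.pos b.left a _); rwa [hb])
        exact ⟨⟨(_, q'), hR'⟩, fun _ => ⟨rfl, hq⟩⟩
      · exact ⟨b, fun h => (hb h).elim⟩
    choose c hc using hmark
    let F : Marked S V (Pairs R) → Marked S V (Pairs R) := fun u =>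
      match u with
      | var (Sum.inr b) => var (Sum.inr (c b))
      | u => t.bind (τ (M u))
    have hF : ∀ u, ¬ u.IsMark → F u = t.bind (τ (M u)) := by
      intro u hu
      cases u with
      | var z =>
        cases z with
        | inl x => rfl
        | inr b => exact (hu trivial).elim
      | app f us => rfl
    have hFun : F ((s.subst σ).unmarked _) = (t.subst σ).unmarked _ := by
      rw [hF _ (not_isMark_unmarked _), hM.unmarked, unmarked_subst]
      exact bind_congr t fun x _ => hτun x
    refine ⟨F, ⟨fun u hu => ?_, fun u v hu huv => ?_, hFun⟩, fun u hu => ?_⟩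
    · by_cases hm : u.IsMark
      · rcases u with (_ | b) | _
        · exact hm.elim
        · exact (hc b hu).1
        · exact hm.elim
      · rw [hF u hm, eval_bind]
        simp only [fun z => (hτ (M u) (hM.eval u hu hm) z).1]
    · have hmono : ¬ u.IsMark → ¬ v.IsMark → MarkLE Pairs.left (F u) (F v) := by
        intro hm hm'
        rw [hF u hm, hF v hm']
        exact .bind (hτmono _ _ (hM.eval u hu hm) (hM.mono u v hu hm hm' huv)) t
      cases huv with
      -- Here `u` is unmarked, so `F u` is too and lies below the marker `c b`. This is why lifts
      -- must preserve unmarked terms.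
      | mark b =>
        rw [eval_unmarked] at hu
        rw [hu, hFun, ← (hc b hu).1]
        exact .mark (c b)
      | var z => exact .refl _
      | app f us vs h => exact hmono id id
    · by_cases hm : u.IsMark
      · rcases u with (_ | b) | _
        · exact hm.elim
        · exact (hc b hu).2
        · exact hm.elim
      · have hτu := hτ (M u) (hM.eval u hu hm)
        have hrule := WSProvable.rule r hr (fun z => (τ (M u) z).eval Pairs.right)
          (fun z => isClosed_eval (l := Pairs.left) (fun b => b.1.2.2) _
            ((hτu z).1 ▸ hσ z)) fun β hβ => ?_
        · rw [hst, Literal.subst, ← eval_bind, ← eval_bind, hsource u hu hm, ← hF u hm] at hrule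
          exact hrule
        · have hpos := hP.1.2 r hr β hβ
          cases β with
          | neg => exact hpos.elim
          | pos t' b w =>
            obtain ⟨y, rfl⟩ := hnt.rhs_var _ _ _ hβ
            obtain ⟨d, hd, rfl, hd'⟩ := hDprem y _ _ hβ
            have := hd' (d.1.bind (τ (M u))) (by simp only [eval_bind, fun z => (hτu z).1])
            -- The equation at `y` makes the target supplied by the premise's lift equal to the
            -- value substituted for `y`.
            rwa [← (hτu y).2.2 d hd, eval_bind] at this

theorem contextClosure.isSimulation (hP : P.IsTyftTyxt)
    {R : ClosedTerm S V → ClosedTerm S V → Prop} (hR : P.lts.IsSimulation R) :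
    P.lts.IsSimulation (contextClosure R) := by
  rintro p q ⟨u, hp, hq⟩ a p' hpp'
  obtain ⟨F, hF, hF'⟩ := WSProvable.exists_isLift hP hR hpp' _ _ _ rfl
  have h := hF' u hp
  exact ⟨⟨_, h.isClosed.2⟩, show P.WSProvable _ from hq ▸ h, F u, hF.eval u hp, rfl⟩

/-- The same context works, with each marker's pair swapped. -/
theorem contextClosure.flip {R Q : ClosedTerm S V → ClosedTerm S V → Prop}
    (h : ∀ p q, R q p → Q p q) (p q : ClosedTerm S V) (hqp : contextClosure R q p) :
    contextClosure Q p q := by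
  obtain ⟨u, hq, hp⟩ := hqp
  let v : Marked S V (Pairs Q) := u.bind fun z => var (z.map id fun b => ⟨b.1.swap, h _ _ b.2⟩)
  refine ⟨v, ?_, ?_⟩
  · rw [← hp, eval, eval, bind_bind]
    congr 1
    funext z
    cases z <;> rfl
  · rw [← hq, eval, eval, bind_bind]
    congr 1
    funext z
    cases z <;> rfl

theorem contextClosure.of {R : ClosedTerm S V → ClosedTerm S V → Prop} {p q : ClosedTerm S V}
    (h : R p q) : contextClosure R p q := ⟨var (Sum.inr ⟨(p, q), h⟩), rfl, rfl⟩

theorem contextClosure.app {R : ClosedTerm S V → ClosedTerm S V → Prop} (f : S.Symb)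
    {ps qs : Fin (S.ar f) → ClosedTerm S V} (h : ∀ i, contextClosure R (ps i) (qs i)) :
    contextClosure R (ClosedTerm.app f ps) (ClosedTerm.app f qs) := by
  choose u hp hq using h
  exact ⟨Term.app f u, congrArg (Term.app f) (funext hp), congrArg (Term.app f) (funext hq)⟩

theorem contextClosure.isNestedSimulation (hP : P.IsTyftTyxt) {n : ℕ}
    {R : ClosedTerm S V → ClosedTerm S V → Prop} (hR : P.lts.IsNestedSimulation n R) :
    P.lts.IsNestedSimulation n (contextClosure R) := by
  induction hR with
  | one hR => exact .one (isSimulation hP hR)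
  | succ hn hR _ hRQ ih => exact .succ hn (isSimulation hP hR) ih (contextClosure.flip hRQ)

theorem IsTyftTyxt.isPrecongruence (hP : P.IsTyftTyxt) {n : ℕ} (hn : 1 ≤ n) :
    IsPrecongruence (P.NestedSimPreorder n) where
  refl p := ⟨_, LTS.isNestedSimulation_eq hn, rfl⟩
  trans := by
    rintro p q s ⟨R, hR, hpq⟩ ⟨Q, hQ, hqs⟩
    exact ⟨_, hR.comp hQ, q, hpq, hqs⟩
  congr f _ _ h :=
    ⟨_, contextClosure.isNestedSimulation hP (LTS.NestedSimPreorder.isNestedSimulation hn),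
      contextClosure.app f fun i => contextClosure.of (h i)⟩

end TSS

theorem mainTheorem5 {V A : Type*} [Infinite V] (hA : Nonempty (A ↪ V))
    (S : Signature) (hS : Nonempty (S.Symb ↪ V))
    (P : TSS S V A) (hP : P.IsTyftTyxt) :
    P.IsComplete ∧ ∀ n : ℕ, 1 ≤ n → IsPrecongruence (P.NestedSimPreorder n) :=
  ⟨hP.1.isComplete, fun _ hn => hP.isPrecongruence hn⟩
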